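/- Let $\gamma>1$ and consider the Euler equations of an ideal gas with a singular source at the origin, $$\partial_t U+\partial_x F(U)=\delta(x)\,S,\qquad U=(\rho,\rho u,E),\quad F(U)=(\rho u,\ \rho u^2+p,\ (E+p)u),\quad p=(\gamma-1)\bigl(E-\tfrac12\rho u^2\bigr),$$ where $S=\mathrm{diag}(k_1,k_2,k_3)F(U_-)$ if the one-sided velocities at the origin satisfy $u_-,u_+>0$, $S=\mathrm{diag}(k_1,k_2,k_3)F(U_+)$ if $u_-,u_+<0$, and $S=0$ otherwise; here $k_1,k_2,k_3>-1$ are constants, not all zero, and $U_\mp=U(0\mp,t)$. An admissible stationary wave is a pair of states $U_-,U_+$ with positive densities and pressures, with nonzero velocities of the same sign, such that $F(U_-)+S(U_-,U_+)=F(U_+)$ and $\lambda_i(U_-)\lambda_i(U_+)\ge 0$ for $i=1,2,3$, where $\lambda_1=u-a$, $\lambda_2=u$, $\lambda_3=u+a$, $a=\sqrt{\gamma p/\rho}$. Put $U_0(x)=U_-$ for $x\le 0$ and $U_0(x)=U_+$ for $x>0$. Let $\Delta t>0$. One step of the splitting method is $U^{n+1}=S^{(\Delta t)}C^{(\Delta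 t)}(U^n)$. Here $C^{(t)}$ is the exact convection step: on two-state data with states $U_L,U_R$ it gives $x\mapsto V(x/t)$, where $V(x/t)$ is an exact solution of the classical Riemann problem for $\partial_tU+\partial_xF(U)=0$, i.e. a self-similar solution that is piecewise smooth (finitely many exceptional rays $x/t=\xi$), satisfies the equation classically between these rays, is continuous across each of them or has there a contact discontinuity or a Lax shock, and tends to $U_L$, $U_R$ as $x/t\to\mp\infty$ (vacuum regions are allowed). $S^{(t)}$ is the exact source step: it solves $\frac{d}{dt}U=\delta(x)S$ at each $x$, with $\delta(x)=0$ for $x\neq0$; the value at the single point $x=0$ is immaterial. Let $a<0<b$. The method is called well-balanced on $(a,b)$ if, for every admissible stationary wave with $u_-,u_+>0$, every sequence $U^0=U_0,U^1,\dots,U^n$ of consecutive steps satisfies $U^n=U_0$ almost everywhere on $(a,b)$. Theorem. For every $\Delta t>0$ and all $a<0<b$, the splitting method is not well-balanced on $(a,b)$. Moreover, for every admissible stationary wave $(U_-,U_+)$: (i) $U_-$ and $U_+$ are connected neither by a stationary contact discontinuity nor by a stationary Lax shock of the classical Euler equations; (ii) every exact convection step moves the state: $\|C^{(\Delta t)}(U_0)-U_0\|_{L^2(a,b)}\neq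 0$; (iii) the source step does not undo this: $\|S^{(\Delta t)}C^{(\Delta t)}(U_0)-U_0\|_{L^2(a,b)}\neq 0$. -/

import Mathlib

open MeasureTheory Filter Topology Set

noncomputable section

namespace SingularEuler

/-- Conserved variables `U = (ρ, ρ u, E)`. -/
abbrev State : Type := EuclideanSpace ℝ (Fin 3)

/-- Velocity `u = (ρ u) / ρ` (it is `0` at the vacuum `U = 0`). -/
def velocity (U : State) : ℝ := U 1 / U 0

/-- Pressure of the ideal gas, `p = (γ - 1) ρ e` with `E = ρ e + ρ u ^ 2 / 2`. -/
def pressure (γ : ℝ) (U : State) : ℝ :=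
  (γ - 1) * (U 2 - U 0 * velocity U ^ 2 / 2)

/-- Euler flux `F(U) = (ρ u, ρ u ^ 2 + p, (E + p) u)`; it vanishes at the vacuum `U = 0`. -/
def flux (γ : ℝ) (U : State) : State :=
  !₂[U 0 * velocity U, U 0 * velocity U ^ 2 + pressure γ U, (U 2 + pressure γ U) * velocity U]

/-- Sound speed `a = √(γ p / ρ)`. -/
def soundSpeed (γ : ℝ) (U : State) : ℝ := √(γ * pressure γ U / U 0)

/-- The characteristic speeds `u - a`, `u`, `u + a`. -/
def charSpeed (γ : ℝ) (U : State) : Fin 3 → ℝ :=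
  ![velocity U - soundSpeed γ U, velocity U, velocity U + soundSpeed γ U]

/-- Non-vacuum gas states: positive density and pressure. -/
def IsGas (γ : ℝ) (U : State) : Prop := 0 < U 0 ∧ 0 < pressure γ U

/-- Physical states: gas or vacuum. -/
def IsPhysical (γ : ℝ) (U : State) : Prop := IsGas γ U ∨ U = 0

/-- The strength of the singular source as a function of the two states at the origin:
`diag(k) F(U₋)` for right-going flow, `diag(k) F(U₊)` for left-going flow, `0` otherwise. -/
def source (γ : ℝ) (k : Fin 3 → ℝ) (Um Up : State) : State :=
  open Classical in
  if 0 < velocity Um ∧ 0 < velocity Up then WithLp.toLp 2 (fun i => k i * flux γ Um i)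
  else if velocity Um < 0 ∧ velocity Up < 0 then WithLp.toLp 2 (fun i => k i * flux γ Up i)
  else 0

/-- Admissible stationary waves: both velocities are nonzero with the same sign, the jump
relation `F(U₋) + S = F(U₊)` holds, and so does the monotonicity criterion
`λᵢ(U₋) λᵢ(U₊) ≥ 0` for all three characteristic speeds. -/
structure IsStationaryWave (γ : ℝ) (k : Fin 3 → ℝ) (Um Up : State) : Prop where
  gas_left : IsGas γ Um
  gas_right : IsGas γ Up
  same_sign : (0 < velocity Um ∧ 0 < velocity Up) ∨ (velocity Um < 0 ∧ velocity Up < 0)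
  jump : flux γ Um + source γ k Um Up = flux γ Up
  monotone : ∀ i, 0 ≤ charSpeed γ Um i * charSpeed γ Up i

/-- Two-state data `U_L` for `x ≤ 0` and `U_R` for `x > 0`. -/
def riemannData (UL UR : State) (x : ℝ) : State := if x ≤ 0 then UL else UR

/-- Contact discontinuity of speed `s`. -/
def IsContact (γ s : ℝ) (Ul Ur : State) : Prop :=
  IsGas γ Ul ∧ IsGas γ Ur ∧ Ul ≠ Ur ∧ flux γ Ur - flux γ Ul = s • (Ur - Ul) ∧
    velocity Ul = s ∧ velocity Ur = s ∧ pressure γ Ul = pressure γ Ur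

/-- Lax shock of the first or third family of speed `s`: the Rankine-Hugoniot relation and
the Lax inequalities. -/
def IsLaxShock (γ s : ℝ) (Ul Ur : State) : Prop :=
  IsGas γ Ul ∧ IsGas γ Ur ∧ flux γ Ur - flux γ Ul = s • (Ur - Ul) ∧
    ((charSpeed γ Ur 0 < s ∧ s < charSpeed γ Ul 0 ∧ s < charSpeed γ Ur 1) ∨
     (charSpeed γ Ur 2 < s ∧ s < charSpeed γ Ul 2 ∧ charSpeed γ Ul 1 < s))

/-- `U(x, t) = V (x / t)` is the exact (self-similar, piecewise smooth, admissible) solution of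
the classical Riemann problem `∂ₜU + ∂ₓF(U) = 0` with left state `UL` and right state `UR`.
There is a finite set `J` of rays `x / t = ξ` such that: off `J` the equation holds in the
classical sense, where for `U = V (x / t)` it reads `F(V)' = ξ V'`; across each ray of `J` the
solution is continuous (edge of a rarefaction wave), or it has a contact discontinuity or a Lax
shock of speed `ξ`. Vacuum regions are allowed. -/
structure IsRiemannSolution (γ : ℝ) (UL UR : State) (V : ℝ → State) : Prop where
  physical : ∀ ξ, IsPhysical γ (V ξ)
  left : Tendsto V atBot (𝓝 UL)
  right : Tendsto V atTop (𝓝 UR)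
  solves : ∃ J : Finset ℝ,
    (∀ ξ, ξ ∉ J → ∃ V' : State,
      HasDerivAt V V' ξ ∧ HasDerivAt (fun η => flux γ (V η)) (ξ • V') ξ) ∧
    (∀ ξ ∈ J, ∃ Vl Vr : State, IsPhysical γ Vl ∧ IsPhysical γ Vr ∧
      Tendsto V (𝓝[<] ξ) (𝓝 Vl) ∧ Tendsto V (𝓝[>] ξ) (𝓝 Vr) ∧
      Tendsto (fun η => flux γ (V η)) (𝓝[<] ξ) (𝓝 (flux γ Vl)) ∧
      Tendsto (fun η => flux γ (V η)) (𝓝[>] ξ) (𝓝 (flux γ Vr)) ∧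
      (Vl = Vr ∨ IsContact γ ξ Vl Vr ∨ IsLaxShock γ ξ Vl Vr))

/-- Exact convection step `W = C^(t) V`. It is defined on two-state data, for which the Cauchy
problem is a Riemann problem; these are the data on which the well-balanced property tests it. -/
def ConvectionStep (γ t : ℝ) (V W : ℝ → State) : Prop :=
  ∃ (UL UR : State) (R : ℝ → State), V =ᵐ[volume] riemannData UL UR ∧
    IsRiemannSolution γ UL UR R ∧ ∀ x, W x = R (x / t)

/-- The singular weight: `δ(x) = 0` for `x ≠ 0` and `δ(0) = ∞`. -/
def delta (x : ℝ) : EReal := open Classical in if x = 0 then ⊤ else 0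

/-- Exact source step `W = S^(t) V`: at each `x` with `δ(x) < ∞` the state follows the ordinary
differential equation `dU/dτ = δ(x) S` for `0 ≤ τ ≤ t`, where `S` is evaluated at the one-sided
limits of `U(·, τ)` at the origin. Nothing is required of the value at the single point `x = 0`,
where the right-hand side is infinite. -/
def SourceStep (γ : ℝ) (k : Fin 3 → ℝ) (t : ℝ) (V W : ℝ → State) : Prop :=
  ∃ (U : ℝ → ℝ → State) (Um Up : ℝ → State),
    (∀ x, U 0 x = V x) ∧ (∀ x, U t x = W x) ∧
    (∀ τ ∈ Icc 0 t, Tendsto (U τ) (𝓝[<] 0) (𝓝 (Um τ)) ∧ Tendsto (U τ) (𝓝[>] 0) (𝓝 (Up τ))) ∧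
    ∀ x, delta x ≠ ⊤ → ∀ τ ∈ Icc 0 t,
      HasDerivWithinAt (fun σ => U σ x) ((delta x).toReal • source γ k (Um τ) (Up τ)) (Icc 0 t) τ

/-- One step of the splitting method, `W = S^(t) C^(t) V`. -/
def SplittingStep (γ : ℝ) (k : Fin 3 → ℝ) (t : ℝ) (V W : ℝ → State) : Prop :=
  ∃ Z : ℝ → State, ConvectionStep γ t V Z ∧ SourceStep γ k t Z W

/-- The splitting method with time step `dt` is well-balanced on the domain `(a, b)`: started
from any admissible stationary wave with right-going flow, every `U^n` that it produces equals
`U^0`. -/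
def IsWellBalanced (γ : ℝ) (k : Fin 3 → ℝ) (dt a b : ℝ) : Prop :=
  ∀ Um Up : State, IsStationaryWave γ k Um Up → 0 < velocity Um →
    ∀ (n : ℕ) (U : ℕ → ℝ → State), U 0 = riemannData Um Up →
      (∀ m < n, SplittingStep γ k dt (U m) (U (m + 1))) →
      U n =ᵐ[volume.restrict (Ioo a b)] U 0

end SingularEuler

end

/-!
The source acts through the weight `δ`, which vanishes for `x ≠ 0`. The source step therefore
changes nothing almost everywhere (`SourceStep.ae_eq`), and the splitting method solves the
source-free equations. It can keep a stationary wave only if the jump from `U₋` to `U₊` is itself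
part of a solution of the classical Riemann problem.

This is impossible. Every exact convection step has one-sided limits at the origin which are equal
or joined by a stationary contact discontinuity or Lax shock (`ConvectionStep.exists_limits`). If
the step equals the stationary wave near the origin, these limits are `U₋` and `U₊`. A stationary
contact has velocity zero, which a stationary wave excludes; in the other two cases
`F(U₋) = F(U₊)`, so the source vanishes, and as all flux components of a moving gas are nonzero,
`k = 0` (`IsStationaryWave.flux_ne`). An exact convection step is continuous off finitely many
points, hence measurable, so that "not almost everywhere equal" gives a nonzero `L²` distance.

The failure of well-balancedness needs more: a stationary wave for which a step of the method
exists. For arbitrary `k` there is a slow, subsonic stationary wave: the jump relation reduces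
to one equation between the Mach numbers of the two sides, which the intermediate value theorem
solves by Mach numbers as small as desired (`exists_isStationaryWave`). Its Riemann problem is
solved exactly (`exists_isRiemannSolution`): a shock or rarefaction of the first family, a contact discontinuity
and a shock or rarefaction of the third family. The waves of the third family are mirror images of
those of the first, and the pressure in the middle is found by the intermediate value theorem; the
small velocities exclude a vacuum.
-/

namespace SingularEuler

/-! ### Primitive variables -/

/-- The state with density `ρ`, velocity `u` and pressure `p`. -/
noncomputable def gasState (γ ρ u p : ℝ) : State := !₂[ρ, ρ * u, p / (γ - 1) + ρ * u ^ 2 / 2]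

@[simp] theorem velocity_gasState {γ ρ u p : ℝ} (hρ : 0 < ρ) : velocity (gasState γ ρ u p) = u := by
  simp [velocity, gasState, hρ.ne']

@[simp] theorem density_gasState (γ ρ u p : ℝ) : gasState γ ρ u p 0 = ρ := rfl

@[simp] theorem pressure_gasState {γ ρ u p : ℝ} (hγ : 1 < γ) (hρ : 0 < ρ) :
    pressure γ (gasState γ ρ u p) = p := by
  have : γ - 1 ≠ 0 := by linarith
  have h2 : gasState γ ρ u p 2 = p / (γ - 1) + ρ * u ^ 2 / 2 := rfl
  rw [pressure, velocity_gasState hρ, density_gasState, h2]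
  field_simp
  ring

theorem soundSpeed_gasState {γ ρ u p : ℝ} (hγ : 1 < γ) (hρ : 0 < ρ) :
    soundSpeed γ (gasState γ ρ u p) = √(γ * p / ρ) := by
  rw [soundSpeed, pressure_gasState hγ hρ, density_gasState]

theorem isGas_gasState {γ ρ u p : ℝ} (hγ : 1 < γ) (hρ : 0 < ρ) (hp : 0 < p) :
    IsGas γ (gasState γ ρ u p) := by
  refine ⟨hρ, ?_⟩
  rwa [pressure_gasState hγ hρ]

theorem flux_gasState {γ ρ u p : ℝ} (hγ : 1 < γ) (hρ : 0 < ρ) :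
    flux γ (gasState γ ρ u p) =
      !₂[ρ * u, ρ * u ^ 2 + p, (γ / (γ - 1) * p + ρ * u ^ 2 / 2) * u] := by
  have : γ - 1 ≠ 0 := by linarith
  have h2 : gasState γ ρ u p 2 = p / (γ - 1) + ρ * u ^ 2 / 2 := rfl
  rw [flux, velocity_gasState hρ, pressure_gasState hγ hρ, density_gasState, h2]
  ext i
  fin_cases i
  · rfl
  · rfl
  · simp
    left
    field_simp
    ring

/-! ### Stationary waves are not waves of the source-free equations -/

/-- If the flux were continuous across a stationary wave, the source would vanish; all three
flux components of a moving gas are nonzero, so this would force `k = 0`. -/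
theorem IsStationaryWave.flux_ne {γ : ℝ} (hγ : 1 < γ) {k : Fin 3 → ℝ} (hk0 : k ≠ 0)
    {Um Up : State} (h : IsStationaryWave γ k Um Up) : flux γ Um ≠ flux γ Up := by
  intro hF
  have hS : source γ k Um Up = 0 := by
    have := h.jump
    rw [← hF] at this
    simpa using this
  have flux_component_ne : ∀ U : State, IsGas γ U → velocity U ≠ 0 → ∀ i, flux γ U i ≠ 0 := by
    intro U hU hu i
    have hp := hU.2
    have hρ := hU.1
    have hE : 0 < U 2 := by
      have : 0 < U 2 - U 0 * velocity U ^ 2 / 2 :=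
        (pos_iff_pos_of_mul_pos hp).1 (by linarith)
      have : 0 ≤ U 0 * velocity U ^ 2 / 2 := by positivity
      linarith
    fin_cases i
    · exact mul_ne_zero hρ.ne' hu
    · exact (by positivity : 0 < U 0 * velocity U ^ 2 + pressure γ U).ne'
    · exact mul_ne_zero (by positivity) hu
  apply hk0
  funext i
  rcases h.same_sign with hs | hs
  · rw [source, if_pos hs] at hS
    have := congrArg (fun U : State => U i) hS
    simpa [flux_component_ne Um h.gas_left hs.1.ne' i] using this
  · rw [source, if_neg (by intro h'; linarith [h'.1, hs.1]), if_pos hs] at hS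
    have := congrArg (fun U : State => U i) hS
    simpa [flux_component_ne Up h.gas_right hs.2.ne i] using this

theorem IsStationaryWave.not_isContact {γ : ℝ} {k : Fin 3 → ℝ}
    {Um Up : State} (h : IsStationaryWave γ k Um Up) : ¬ IsContact γ 0 Um Up := by
  rintro ⟨-, -, -, -, hu, -⟩
  rcases h.same_sign with hs | hs <;> linarith [hs.1]

theorem IsStationaryWave.not_isLaxShock {γ : ℝ} (hγ : 1 < γ) {k : Fin 3 → ℝ} (hk0 : k ≠ 0)
    {Um Up : State} (h : IsStationaryWave γ k Um Up) : ¬ IsLaxShock γ 0 Um Up := by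
  rintro ⟨-, -, hF, -⟩
  rw [zero_smul, sub_eq_zero] at hF
  exact h.flux_ne hγ hk0 hF.symm

/-! ### The convection step at the origin -/

/-- An exact convection step has one-sided limits at the origin, and these are equal or joined by
a stationary contact discontinuity or a stationary Lax shock. -/
theorem ConvectionStep.exists_limits {γ t : ℝ} (ht : 0 < t) {V Z : ℝ → State}
    (h : ConvectionStep γ t V Z) : ∃ Vl Vr : State,
      Tendsto Z (𝓝[<] 0) (𝓝 Vl) ∧ Tendsto Z (𝓝[>] 0) (𝓝 Vr) ∧
      (Vl = Vr ∨ IsContact γ 0 Vl Vr ∨ IsLaxShock γ 0 Vl Vr) := by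
  obtain ⟨UL, UR, R, -, hR, hZ⟩ := h
  obtain ⟨J, hJ, hJ'⟩ := hR.solves
  have hZR : Z = fun x => R (x / t) := funext hZ
  have hc : Tendsto (fun x : ℝ => x / t) (𝓝 0) (𝓝 0) := by
    have : Continuous (fun x : ℝ => x / t) := by fun_prop
    simpa using this.tendsto 0
  have hl : Tendsto (fun x : ℝ => x / t) (𝓝[<] 0) (𝓝[<] 0) := by
    refine tendsto_nhdsWithin_iff.2 ⟨hc.mono_left nhdsWithin_le_nhds, ?_⟩
    filter_upwards [self_mem_nhdsWithin] with x hx using div_neg_of_neg_of_pos hx ht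
  have hr : Tendsto (fun x : ℝ => x / t) (𝓝[>] 0) (𝓝[>] 0) := by
    refine tendsto_nhdsWithin_iff.2 ⟨hc.mono_left nhdsWithin_le_nhds, ?_⟩
    filter_upwards [self_mem_nhdsWithin] with x hx using div_pos hx ht
  subst hZR
  by_cases h0 : (0 : ℝ) ∈ J
  · obtain ⟨Vl, Vr, -, -, h1, h2, -, -, h3⟩ := hJ' 0 h0
    exact ⟨Vl, Vr, h1.comp hl, h2.comp hr, h3⟩
  · obtain ⟨V', hV', -⟩ := hJ 0 h0
    have := hV'.continuousAt.tendsto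
    exact ⟨R 0, R 0, (this.mono_left nhdsWithin_le_nhds).comp hl,
      (this.mono_left nhdsWithin_le_nhds).comp hr, Or.inl rfl⟩

/-- An exact convection step is continuous off finitely many points, hence measurable. -/
theorem ConvectionStep.aestronglyMeasurable {γ t : ℝ} (ht : 0 < t) {V Z : ℝ → State}
    (h : ConvectionStep γ t V Z) : AEStronglyMeasurable Z volume := by
  obtain ⟨UL, UR, R, -, hR, hZ⟩ := h
  obtain ⟨J, hJ, -⟩ := hR.solves
  have hZR : Z = fun x => R (x / t) := funext hZ
  let N : Set ℝ := (fun x : ℝ => x / t) ⁻¹' J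
  have hN : N.Finite := J.finite_toSet.preimage
    (fun x _ y _ hxy => (div_left_inj' ht.ne').1 hxy)
  have hcont : ContinuousOn Z Nᶜ := by
    intro x hx
    obtain ⟨V', hV', -⟩ := hJ (x / t) hx
    rw [hZR]
    exact (ContinuousAt.comp (f := fun x : ℝ => x / t) hV'.continuousAt
      (by fun_prop)).continuousWithinAt
  have := hcont.aestronglyMeasurable (μ := volume) hN.measurableSet.compl
  rwa [Measure.restrict_eq_self_of_ae_mem] at this
  exact compl_mem_ae_iff.2 (hN.measure_zero _)

/-- A limit along a filter that does not charge null sets is determined by the almost everywhere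
value of the function. -/
theorem eq_of_tendsto_of_ae_eq_const {E : Type*} [TopologicalSpace E] [T2Space E]
    {f : ℝ → E} {c d : ℝ} {l : Filter ℝ} {y z : E}
    (hl : ∀ N : Set ℝ, volume N = 0 → ∃ᶠ x in l, x ∈ Ioo c d \ N)
    (hf : Tendsto f l (𝓝 y)) (hae : ∀ᵐ x ∂volume.restrict (Ioo c d), f x = z) : y = z := by
  rw [ae_restrict_iff' measurableSet_Ioo] at hae
  have hfr : ∃ᶠ x in l, f x = z := by
    refine (hl _ hae).mono ?_
    rintro x ⟨hx, hx'⟩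
    by_contra hne
    exact hx' (fun h => hne (h hx))
  by_contra hne
  obtain ⟨s, hs⟩ := (hf.eventually_ne hne).and_frequently hfr |>.exists
  exact hs.1 hs.2

theorem frequently_left_mem_diff_null {a b : ℝ} (ha : a < 0) (hb : 0 ≤ b) (N : Set ℝ)
    (hN : volume N = 0) : ∃ᶠ x in 𝓝[<] (0 : ℝ), x ∈ Ioo a b \ N := by
  intro hev
  obtain ⟨e, he, hsub⟩ := mem_nhdsLT_iff_exists_Ioo_subset.1 hev
  have hsub' : Ioo (max a e) 0 ⊆ N := by
    intro x hx
    by_contra hxN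
    exact hsub ⟨(le_max_right _ _).trans_lt hx.1, hx.2⟩
      ⟨⟨(le_max_left _ _).trans_lt hx.1, hx.2.trans_le hb⟩, hxN⟩
  have := measure_mono_null hsub' hN
  rw [Real.volume_Ioo, ENNReal.ofReal_eq_zero] at this
  have := max_lt ha he
  linarith

theorem frequently_right_mem_diff_null {a b : ℝ} (ha : a ≤ 0) (hb : 0 < b) (N : Set ℝ)
    (hN : volume N = 0) : ∃ᶠ x in 𝓝[>] (0 : ℝ), x ∈ Ioo a b \ N := by
  intro hev
  obtain ⟨e, he, hsub⟩ := mem_nhdsGT_iff_exists_Ioo_subset.1 hev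
  have hsub' : Ioo 0 (min b e) ⊆ N := by
    intro x hx
    by_contra hxN
    exact hsub ⟨hx.1, hx.2.trans_le (min_le_right _ _)⟩
      ⟨⟨ha.trans_lt hx.1, hx.2.trans_le (min_le_left _ _)⟩, hxN⟩
  have := measure_mono_null hsub' hN
  rw [Real.volume_Ioo, ENNReal.ofReal_eq_zero] at this
  have := lt_min hb he
  linarith

/-- The exact convection step moves every stationary wave: otherwise the two states of the wave
would be the one-sided limits at the origin of a solution of the source-free equations. -/
theorem IsStationaryWave.not_ae_eq {γ : ℝ} (hγ : 1 < γ) {k : Fin 3 → ℝ} (hk0 : k ≠ 0)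
    {Um Up : State} (h : IsStationaryWave γ k Um Up) {t : ℝ} (ht : 0 < t) {a b : ℝ}
    (ha : a < 0) (hb : 0 < b) {V Z : ℝ → State} (hZ : ConvectionStep γ t V Z) :
    ¬ Z =ᵐ[volume.restrict (Ioo a b)] riemannData Um Up := by
  intro hae
  obtain ⟨Vl, Vr, h1, h2, h3⟩ := hZ.exists_limits ht
  have hl : Vl = Um := by
    refine eq_of_tendsto_of_ae_eq_const (frequently_left_mem_diff_null ha le_rfl) h1 ?_
    have := ae_restrict_of_ae_restrict_of_subset (Ioo_subset_Ioo_right hb.le) hae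
    filter_upwards [this, ae_restrict_mem measurableSet_Ioo] with x hx hx'
    rw [hx, riemannData, if_pos hx'.2.le]
  have hr : Vr = Up := by
    refine eq_of_tendsto_of_ae_eq_const (frequently_right_mem_diff_null le_rfl hb) h2 ?_
    have := ae_restrict_of_ae_restrict_of_subset (Ioo_subset_Ioo_left ha.le) hae
    filter_upwards [this, ae_restrict_mem measurableSet_Ioo] with x hx hx'
    rw [hx, riemannData, if_neg (not_le.2 hx'.1)]
  subst hl hr
  rcases h3 with h3 | h3 | h3
  · exact h.flux_ne hγ hk0 (by rw [h3])
  · exact h.not_isContact h3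
  · exact h.not_isLaxShock hγ hk0 h3

theorem measurable_riemannData (Um Up : State) : Measurable (riemannData Um Up) :=
  Measurable.ite measurableSet_Iic measurable_const measurable_const

theorem IsStationaryWave.eLpNorm_ne_zero {γ : ℝ} (hγ : 1 < γ) {k : Fin 3 → ℝ} (hk0 : k ≠ 0)
    {Um Up : State} (h : IsStationaryWave γ k Um Up) {t : ℝ} (ht : 0 < t) {a b : ℝ}
    (ha : a < 0) (hb : 0 < b) {V Z : ℝ → State} (hZ : ConvectionStep γ t V Z)
    {W : ℝ → State} (hW : W =ᵐ[volume] Z) :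
    eLpNorm (fun x => W x - riemannData Um Up x) 2 (volume.restrict (Ioo a b)) ≠ 0 := by
  intro h0
  have hm : AEStronglyMeasurable (fun x => W x - riemannData Um Up x)
      (volume.restrict (Ioo a b)) :=
    (((hZ.aestronglyMeasurable ht).congr hW.symm).sub
      (measurable_riemannData Um Up).aestronglyMeasurable).restrict
  rw [eLpNorm_eq_zero_iff hm two_ne_zero] at h0
  refine h.not_ae_eq hγ hk0 ht ha hb hZ ?_
  filter_upwards [h0, ae_restrict_of_ae hW] with x hx hx'
  rw [← hx']
  exact sub_eq_zero.1 hx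

/-- Away from the origin the singular weight vanishes, so the source step changes nothing. -/
theorem SourceStep.ae_eq {γ : ℝ} {k : Fin 3 → ℝ} {t : ℝ} (ht : 0 < t) {V W : ℝ → State}
    (h : SourceStep γ k t V W) : W =ᵐ[volume] V := by
  obtain ⟨U, Um, Up, h0, h1, -, hd⟩ := h
  have hne : ∀ᵐ x : ℝ, x ≠ 0 := by simp [ae_iff, measure_singleton]
  filter_upwards [hne] with x hx
  have hδ : delta x = 0 := by simp [delta, hx]
  have hd' : ∀ τ ∈ Icc 0 t, HasDerivWithinAt (fun σ => U σ x) 0 (Icc 0 t) τ := by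
    intro τ hτ
    simpa [hδ] using hd x (by simp [hδ]) τ hτ
  rw [← h0, ← h1]
  refine constant_of_derivWithin_zero (fun τ hτ => (hd' τ hτ).differentiableWithinAt) ?_ t
    (right_mem_Icc.2 ht.le)
  intro τ hτ
  exact (hd' τ (Ico_subset_Icc_self hτ)).derivWithin
    (uniqueDiffOn_Icc ht τ (Ico_subset_Icc_self hτ))

/-! ### Self-similar solutions, locally -/

/-- The self-similar form `F(V)' = ξ V'` of the Euler equations holds at `ξ` in the classical
sense. -/
def SolvesAt (γ : ℝ) (V : ℝ → State) (ξ : ℝ) : Prop :=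
  ∃ V' : State, HasDerivAt V V' ξ ∧ HasDerivAt (fun η => flux γ (V η)) (ξ • V') ξ

/-- At `ξ` the profile `V` is continuous, or it has a contact discontinuity or a Lax shock. -/
def AdmissibleAt (γ : ℝ) (V : ℝ → State) (ξ : ℝ) : Prop :=
  ∃ Vl Vr : State, IsPhysical γ Vl ∧ IsPhysical γ Vr ∧
    Tendsto V (𝓝[<] ξ) (𝓝 Vl) ∧ Tendsto V (𝓝[>] ξ) (𝓝 Vr) ∧
    Tendsto (fun η => flux γ (V η)) (𝓝[<] ξ) (𝓝 (flux γ Vl)) ∧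
    Tendsto (fun η => flux γ (V η)) (𝓝[>] ξ) (𝓝 (flux γ Vr)) ∧
    (Vl = Vr ∨ IsContact γ ξ Vl Vr ∨ IsLaxShock γ ξ Vl Vr)

theorem SolvesAt.congr {γ : ℝ} {V W : ℝ → State} {ξ : ℝ} (h : SolvesAt γ V ξ)
    (hW : W =ᶠ[𝓝 ξ] V) : SolvesAt γ W ξ := by
  obtain ⟨V', h1, h2⟩ := h
  exact ⟨V', h1.congr_of_eventuallyEq hW, h2.congr_of_eventuallyEq (hW.fun_comp (flux γ))⟩

theorem AdmissibleAt.congr {γ : ℝ} {V W : ℝ → State} {ξ : ℝ} (h : AdmissibleAt γ V ξ)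
    (hW : W =ᶠ[𝓝 ξ] V) : AdmissibleAt γ W ξ := by
  obtain ⟨Vl, Vr, hl, hr, h1, h2, h3, h4, h5⟩ := h
  have hL := hW.filter_mono (nhdsWithin_le_nhds (s := Iio ξ))
  have hR := hW.filter_mono (nhdsWithin_le_nhds (s := Ioi ξ))
  exact ⟨Vl, Vr, hl, hr, h1.congr' hL.symm, h2.congr' hR.symm,
    h3.congr' (hL.fun_comp (flux γ)).symm, h4.congr' (hR.fun_comp (flux γ)).symm, h5⟩

theorem solvesAt_const (γ : ℝ) (U : State) (ξ : ℝ) : SolvesAt γ (fun _ => U) ξ :=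
  ⟨0, hasDerivAt_const _ _, by simpa using hasDerivAt_const ξ (flux γ U)⟩

theorem SolvesAt.of_eventually_eq {γ : ℝ} {V : ℝ → State} {ξ : ℝ} {U : State}
    (h : ∀ᶠ η in 𝓝 ξ, V η = U) : SolvesAt γ V ξ :=
  (solvesAt_const γ U ξ).congr h

theorem AdmissibleAt.of_eq_of_eq {γ : ℝ} {V : ℝ → State} {ξ : ℝ} {Vl Vr : State}
    (hl : IsPhysical γ Vl) (hr : IsPhysical γ Vr) (h1 : ∀ᶠ η in 𝓝[<] ξ, V η = Vl)
    (h2 : ∀ᶠ η in 𝓝[>] ξ, V η = Vr)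
    (h : Vl = Vr ∨ IsContact γ ξ Vl Vr ∨ IsLaxShock γ ξ Vl Vr) : AdmissibleAt γ V ξ :=
  ⟨Vl, Vr, hl, hr, tendsto_const_nhds.congr' (h1.mono fun _ h => h.symm),
    tendsto_const_nhds.congr' (h2.mono fun _ h => h.symm),
    tendsto_const_nhds.congr' (h1.mono fun _ h => congrArg (flux γ) h.symm),
    tendsto_const_nhds.congr' (h2.mono fun _ h => congrArg (flux γ) h.symm), h⟩

theorem continuousAt_triple {X : Type*} [TopologicalSpace X] {f g h : X → ℝ} {x : X}
    (hf : ContinuousAt f x) (hg : ContinuousAt g x) (hh : ContinuousAt h x) :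
    ContinuousAt (fun y => (!₂[f y, g y, h y] : State)) x := by
  refine (PiLp.continuous_toLp 2 _).continuousAt.comp (continuousAt_pi.2 fun i => ?_)
  fin_cases i <;> assumption

theorem hasDerivAt_triple {f g h : ℝ → ℝ} {f' g' h' x : ℝ}
    (hf : HasDerivAt f f' x) (hg : HasDerivAt g g' x) (hh : HasDerivAt h h' x) :
    HasDerivAt (fun y => (!₂[f y, g y, h y] : State)) !₂[f', g', h'] x := by
  have h1 : HasDerivAt (fun y => ![f y, g y, h y]) ![f', g', h'] x := by
    refine hasDerivAt_pi.2 fun i => ?_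
    fin_cases i <;> assumption
  exact (PiLp.hasFDerivAt_toLp (𝕜 := ℝ) 2 (E := fun _ : Fin 3 => ℝ)
    ![f x, g x, h x]).comp_hasDerivAt x h1

theorem continuousAt_flux (γ : ℝ) {U : State} (hU : U 0 ≠ 0) : ContinuousAt (flux γ) U := by
  have h : ∀ i, ContinuousAt (fun W : State => W i) U := fun i => by fun_prop
  have hv : ContinuousAt velocity U := (h 1).div (h 0) hU
  have hp : ContinuousAt (pressure γ) U :=
    continuousAt_const.mul ((h 2).sub (((h 0).mul (hv.pow 2)).div_const 2))
  exact continuousAt_triple ((h 0).mul hv) (((h 0).mul (hv.pow 2)).add hp)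
    (((h 2).add hp).mul hv)

theorem AdmissibleAt.of_continuousAt {γ : ℝ} {V : ℝ → State} {ξ : ℝ} (hV : IsPhysical γ (V ξ))
    (h : ContinuousAt V ξ) (hF : ContinuousAt (fun η => flux γ (V η)) ξ) : AdmissibleAt γ V ξ :=
  ⟨V ξ, V ξ, hV, hV, h.tendsto.mono_left nhdsWithin_le_nhds,
    h.tendsto.mono_left nhdsWithin_le_nhds, hF.tendsto.mono_left nhdsWithin_le_nhds,
    hF.tendsto.mono_left nhdsWithin_le_nhds, Or.inl rfl⟩

theorem SolvesAt.admissibleAt {γ : ℝ} {V : ℝ → State} {ξ : ℝ} (h : SolvesAt γ V ξ)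
    (hV : IsPhysical γ (V ξ)) : AdmissibleAt γ V ξ := by
  obtain ⟨V', h1, h2⟩ := h
  exact AdmissibleAt.of_continuousAt hV h1.continuousAt h2.continuousAt

/-! ### Waves of the first family -/

/-- The Rankine-Hugoniot relation and the Lax inequalities for a shock of the first family of
speed `s`, with relative velocities `w₀`, `w₁` and mass flux `q`. -/
theorem isLaxShock_gasState {γ ρ₀ ρ₁ p₀ p₁ s w₀ w₁ q : ℝ} (hγ : 1 < γ) (hρ₀ : 0 < ρ₀)
    (hρ₁ : 0 < ρ₁) (hp₀ : 0 < p₀) (hp : p₀ < p₁) (hw₀ : 0 < w₀) (hw₁ : 0 < w₁)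
    (h₀ : ρ₀ * w₀ = q) (h₁ : ρ₁ * w₁ = q)
    (hq₀ : q * w₀ = ((γ + 1) * p₁ + (γ - 1) * p₀) / 2)
    (hq₁ : q * w₁ = ((γ - 1) * p₁ + (γ + 1) * p₀) / 2) :
    IsLaxShock γ s (gasState γ ρ₀ (s + w₀) p₀) (gasState γ ρ₁ (s + w₁) p₁) := by
  have hp₁ := hp₀.trans hp
  have hg : γ - 1 ≠ 0 := by linarith
  refine ⟨isGas_gasState hγ hρ₀ hp₀, isGas_gasState hγ hρ₁ hp₁, ?_, Or.inl ⟨?_, ?_, ?_⟩⟩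
  · have hq : 0 < q := h₀ ▸ mul_pos hρ₀ hw₀
    have h₃ : q * (w₀ - w₁) = p₁ - p₀ := by rw [mul_sub, hq₀, hq₁]; ring
    have h₄ : w₁ * ((γ + 1) * p₁ + (γ - 1) * p₀) = w₀ * ((γ - 1) * p₁ + (γ + 1) * p₀) := by
      linear_combination (-2 * w₁) * hq₀ + 2 * w₀ * hq₁
    rw [flux_gasState hγ hρ₀, flux_gasState hγ hρ₁]
    ext i
    fin_cases i
    · simp [gasState]
      linear_combination h₁ - h₀
    · simp [gasState]
      linear_combination (s + w₁) * h₁ - (s + w₀) * h₀ - h₃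
    · simp [gasState]
      field_simp
      linear_combination (γ - 1) * (s + w₁) ^ 2 * h₁ - (γ - 1) * (s + w₀) ^ 2 * h₀
        - (γ - 1) * (2 * s + w₀ + w₁) * h₃ + h₄
  · have : w₁ < √(γ * p₁ / ρ₁) := by
      rw [Real.lt_sqrt hw₁.le, lt_div_iff₀ hρ₁]
      have : w₁ ^ 2 * ρ₁ = q * w₁ := by rw [← h₁]; ring
      rw [this, hq₁]
      nlinarith
    simp only [charSpeed, Matrix.cons_val_zero]
    rw [soundSpeed_gasState hγ hρ₁, velocity_gasState hρ₁]
    linarith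
  · have : √(γ * p₀ / ρ₀) < w₀ := by
      rw [Real.sqrt_lt' hw₀, div_lt_iff₀ hρ₀]
      have : w₀ ^ 2 * ρ₀ = q * w₀ := by rw [← h₀]; ring
      rw [this, hq₀]
      nlinarith
    simp only [charSpeed, Matrix.cons_val_zero]
    rw [soundSpeed_gasState hγ hρ₀, velocity_gasState hρ₀]
    linarith
  · simp only [charSpeed, Matrix.cons_val_one, Matrix.cons_val_zero]
    rw [velocity_gasState hρ₁]
    linarith

/-- The velocity lost across a wave of the first family that leads from density `ρ₀` and pressure
`p₀` to pressure `p`. One of the two summands is zero: the first is the contribution of a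
rarefaction (`p ≤ p₀`), the second that of a shock (`p₀ ≤ p`). -/
noncomputable def waveCurve (γ ρ₀ p₀ p : ℝ) : ℝ :=
  2 / (γ - 1) * √(γ * p₀ / ρ₀) * ((min p p₀ / p₀) ^ ((γ - 1) / (2 * γ)) - 1) +
    (max p p₀ - p₀) / √(ρ₀ * ((γ + 1) * max p p₀ + (γ - 1) * p₀) / 2)

/-- A wave of the first family, as a Riemann solution from `U` to the state `Us` behind the wave.
The wave is slower than the gas behind it, so that a contact discontinuity can follow. -/
def IsLeftWave (γ : ℝ) (U Us : State) (V : ℝ → State) : Prop :=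
  IsRiemannSolution γ U Us V ∧ ∃ σ < velocity Us, ∀ ξ, σ < ξ → V ξ = Us

/-- A jump of pressure from `p₀` up to `p` by a Lax shock: `q` is the mass flux through the shock
and `w₀`, `w₁` are the velocities relative to it. -/
theorem exists_shock {γ : ℝ} (hγ : 1 < γ) {ρ₀ p₀ p : ℝ} (u₀ : ℝ) (hρ₀ : 0 < ρ₀) (hp₀ : 0 < p₀)
    (hp : p₀ < p) : ∃ ρ V, 0 < ρ ∧ IsLeftWave γ (gasState γ ρ₀ u₀ p₀)
      (gasState γ ρ (u₀ - waveCurve γ ρ₀ p₀ p) p) V := by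
  have hg : 0 < γ - 1 := by linarith
  have hp' : 0 < p := hp₀.trans hp
  set A := (γ + 1) * p + (γ - 1) * p₀ with hA
  set B := (γ - 1) * p + (γ + 1) * p₀ with hB
  have hA0 : 0 < A := by positivity
  have hB0 : 0 < B := by positivity
  set q := √(ρ₀ * A / 2) with hq
  have hq0 : 0 < q := by positivity
  have hqq : q ^ 2 = ρ₀ * A / 2 := Real.sq_sqrt (by positivity)
  have hcurve : waveCurve γ ρ₀ p₀ p = (p - p₀) / q := by
    simp [waveCurve, max_eq_left hp.le, min_eq_right hp.le, hp₀.ne', hq, hA]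
  set w₀ := A / (2 * q) with hw₀
  set w₁ := B / (2 * q) with hw₁
  have hw₀' : 0 < w₀ := by positivity
  have hw₁' : 0 < w₁ := by positivity
  have hu : u₀ - waveCurve γ ρ₀ p₀ p = u₀ - w₀ + w₁ := by
    rw [hcurve, hw₀, hw₁, hA, hB]
    field_simp
    ring
  have hshock := isLaxShock_gasState (s := u₀ - w₀) hγ hρ₀ (ρ₁ := q / w₁) (by positivity) hp₀ hp
    hw₀' hw₁' (q := q) (by rw [hw₀]; field_simp; linarith) (by field_simp)
    (by rw [hw₀]; field_simp; exact hA) (by rw [hw₁]; field_simp; exact hB)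
  rw [sub_add_cancel, ← hu] at hshock
  set U := gasState γ ρ₀ u₀ p₀
  set Us := gasState γ (q / w₁) (u₀ - waveCurve γ ρ₀ p₀ p) p
  set s := u₀ - w₀ with hs
  refine ⟨q / w₁, fun ξ => if ξ ≤ s then U else Us, by positivity, ?_, s, ?_, ?_⟩
  · refine ⟨?_, ?_, ?_, {s}, ?_, ?_⟩
    · intro ξ
      split_ifs
      exacts [Or.inl hshock.1, Or.inl hshock.2.1]
    · refine tendsto_const_nhds.congr' ?_
      filter_upwards [eventually_le_atBot s] with ξ hξ
      rw [if_pos hξ]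
    · refine tendsto_const_nhds.congr' ?_
      filter_upwards [eventually_gt_atTop s] with ξ hξ
      rw [if_neg (not_le.2 hξ)]
    · intro ξ hξ
      rcases lt_or_gt_of_ne (Finset.notMem_singleton.1 hξ) with h | h
      · refine SolvesAt.of_eventually_eq (U := U) ?_
        filter_upwards [Iio_mem_nhds h] with η hη
        rw [if_pos (le_of_lt hη)]
      · refine SolvesAt.of_eventually_eq (U := Us) ?_
        filter_upwards [Ioi_mem_nhds h] with η hη
        rw [if_neg (not_le.2 hη)]
    · intro ξ hξ
      rw [Finset.mem_singleton.1 hξ]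
      refine AdmissibleAt.of_eq_of_eq (Or.inl hshock.1) (Or.inl hshock.2.1) ?_ ?_
        (Or.inr (Or.inr hshock))
      · filter_upwards [self_mem_nhdsWithin] with η hη
        rw [if_pos (le_of_lt hη)]
      · filter_upwards [self_mem_nhdsWithin] with η hη
        rw [if_neg (not_le.2 hη)]
  · rw [velocity_gasState (by positivity), hu]
    linarith
  · intro ξ hξ
    exact if_neg (not_le.2 hξ)

/-- The integral curve of the first family through the state with density `ρ₀`, velocity `u₀` and
sound speed `c₀`, parametrised by the sound speed `c`. The entropy and the Riemann invariant
`u + 2 c / (γ - 1)` are constant along it. -/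
noncomputable def rarefactionCurve (γ ρ₀ u₀ c₀ c : ℝ) : State :=
  gasState γ (ρ₀ * (c / c₀) ^ (2 / (γ - 1))) (u₀ + 2 / (γ - 1) * (c₀ - c))
    (ρ₀ * (c / c₀) ^ (2 / (γ - 1)) * c ^ 2 / γ)

/-- The tangent of the curve is an eigenvector of the Jacobian of the flux for the eigenvalue
`u - c`. -/
theorem hasDerivAt_rarefactionCurve {γ ρ₀ c₀ c : ℝ} (hγ : 1 < γ) (u₀ : ℝ) (hρ₀ : 0 < ρ₀)
    (hc₀ : 0 < c₀) (hc : 0 < c) : ∃ W' : State,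
      HasDerivAt (rarefactionCurve γ ρ₀ u₀ c₀) W' c ∧
      HasDerivAt (fun x => flux γ (rarefactionCurve γ ρ₀ u₀ c₀ x))
        ((u₀ + 2 / (γ - 1) * (c₀ - c) - c) • W') c := by
  have hg : γ - 1 ≠ 0 := by linarith
  have hγ0 : γ ≠ 0 := by linarith
  set R : ℝ → ℝ := fun x => ρ₀ * (x / c₀) ^ (2 / (γ - 1)) with hR
  set u : ℝ → ℝ := fun x => u₀ + 2 / (γ - 1) * (c₀ - x) with hu
  have hRpos : ∀ x, 0 < x → 0 < R x := fun x hx => by simp only [hR]; positivity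
  have dR : HasDerivAt R (2 / (γ - 1) * R c / c) c := by
    have h1 : HasDerivAt (fun x : ℝ => x / c₀) (1 / c₀) c := (hasDerivAt_id c).div_const c₀
    have h2 := ((Real.hasDerivAt_rpow_const (p := 2 / (γ - 1))
      (Or.inl (div_pos hc hc₀).ne')).comp c h1).const_mul ρ₀
    refine h2.congr_deriv ?_
    rw [Real.rpow_sub_one (div_pos hc hc₀).ne']
    simp only [hR]
    field_simp
  have du : HasDerivAt u (-(2 / (γ - 1))) c := by
    have := (((hasDerivAt_id c).const_sub c₀).const_mul (2 / (γ - 1))).const_add u₀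
    exact this.congr_deriv (by ring)
  have dp : HasDerivAt (fun x => R x * x ^ 2 / γ)
      ((2 / (γ - 1) * R c / c * c ^ 2 + R c * (2 * c)) / γ) c := by
    simpa using (dR.mul (hasDerivAt_pow 2 c)).div_const γ
  have du2 : HasDerivAt (fun x => u x ^ 2) (2 * u c * (-(2 / (γ - 1)))) c := by
    exact (du.pow 2).congr_deriv (by simp)
  have dm := dR.mul du
  have dK := dR.mul du2
  refine ⟨_, hasDerivAt_triple dR dm ((dp.div_const (γ - 1)).add (dK.div_const 2)), ?_⟩
  have hF : (fun x => flux γ (rarefactionCurve γ ρ₀ u₀ c₀ x)) =ᶠ[𝓝 c] fun x =>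
      !₂[R x * u x, R x * u x ^ 2 + R x * x ^ 2 / γ,
        (γ / (γ - 1) * (R x * x ^ 2 / γ) + R x * u x ^ 2 / 2) * u x] := by
    filter_upwards [Ioi_mem_nhds hc] with x hx
    exact flux_gasState hγ (hRpos x hx)
  refine HasDerivAt.congr_of_eventuallyEq ?_ hF
  refine (hasDerivAt_triple dm (dK.add dp)
    (((dp.const_mul (γ / (γ - 1))).add (dK.div_const 2)).mul du)).congr_deriv ?_
  have hcurrent : u₀ + 2 / (γ - 1) * (c₀ - c) = u c := rfl
  rw [hcurrent]
  ext i
  fin_cases i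
  · simp
    field_simp
    ring
  · simp
    field_simp
    ring
  · simp
    field_simp
    ring

/-- A drop of pressure from `p₀` to `p` by a centred rarefaction: the profile runs through the
rarefaction curve with `u - c = ξ`, and is constant outside the fan. For `p = p₀` the fan is a
single ray and the profile is constant. -/
theorem exists_rarefaction {γ : ℝ} (hγ : 1 < γ) {ρ₀ p₀ p : ℝ} (u₀ : ℝ) (hρ₀ : 0 < ρ₀)
    (hp₀ : 0 < p₀) (hp' : 0 < p) (hp : p ≤ p₀) : ∃ ρ V, 0 < ρ ∧
      IsLeftWave γ (gasState γ ρ₀ u₀ p₀) (gasState γ ρ (u₀ - waveCurve γ ρ₀ p₀ p) p) V := by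
  have hg : 0 < γ - 1 := by linarith
  have hγ0 : 0 < γ := by linarith
  set c₀ := √(γ * p₀ / ρ₀) with hc₀
  have hc₀' : 0 < c₀ := by positivity
  have hcc : c₀ ^ 2 = γ * p₀ / ρ₀ := Real.sq_sqrt (by positivity)
  set θ := (p / p₀) ^ ((γ - 1) / (2 * γ)) with hθ
  have hθ0 : 0 < θ := by positivity
  have hθ1 : θ ≤ 1 := Real.rpow_le_one (by positivity) ((div_le_one hp₀).2 hp) (by positivity)
  set c₁ := c₀ * θ with hc₁
  have hc₁' : 0 < c₁ := by positivity
  have hc₁₀ : c₁ ≤ c₀ := mul_le_of_le_one_right hc₀'.le hθ1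
  have hcurve : waveCurve γ ρ₀ p₀ p = -(2 / (γ - 1) * (c₀ - c₁)) := by
    simp only [waveCurve, max_eq_right hp, min_eq_left hp, ← hc₀, ← hθ, hc₁]
    simp
    ring
  set W := rarefactionCurve γ ρ₀ u₀ c₀ with hW
  have hW₀ : W c₀ = gasState γ ρ₀ u₀ p₀ := by
    simp only [hW, rarefactionCurve, div_self hc₀'.ne', Real.one_rpow, sub_self, hcc]
    congr 1
    · ring
    · ring
    · field_simp
  set ρ₁ := ρ₀ * (c₁ / c₀) ^ (2 / (γ - 1)) with hρ₁
  have hρ₁' : 0 < ρ₁ := by positivity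
  have hW₁ : W c₁ = gasState γ ρ₁ (u₀ - waveCurve γ ρ₀ p₀ p) p := by
    rw [hcurve, sub_neg_eq_add]
    simp only [hW, rarefactionCurve, ← hρ₁]
    congr 1
    -- the isentropic relation `p / p₀ = (c / c₀) ^ (2 γ / (γ - 1))`
    have h1 : c₁ / c₀ = θ := by rw [hc₁]; field_simp
    have h2 : θ ^ (2 / (γ - 1)) * θ ^ 2 = p / p₀ := by
      rw [← Real.rpow_natCast θ 2, ← Real.rpow_add hθ0, hθ, ← Real.rpow_mul (by positivity)]
      convert Real.rpow_one (p / p₀)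
      push_cast
      field_simp
      ring
    rw [hρ₁, h1]
    calc ρ₀ * θ ^ (2 / (γ - 1)) * c₁ ^ 2 / γ
        = ρ₀ * c₀ ^ 2 * (θ ^ (2 / (γ - 1)) * θ ^ 2) / γ := by rw [hc₁]; ring
      _ = p := by rw [h2, hcc]; field_simp
  have hWgas : ∀ c, 0 < c → IsGas γ (W c) := fun c hc =>
    isGas_gasState hγ (by positivity) (by positivity)
  -- the sound speed inside the fan, from `u - c = ξ`
  set f : ℝ → ℝ := fun ξ => (γ - 1) / (γ + 1) * (u₀ + 2 / (γ - 1) * c₀ - ξ) with hf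
  have hfc : Continuous f := by fun_prop
  set V : ℝ → State := fun ξ => W (max c₁ (min c₀ (f ξ))) with hV
  have hpos : ∀ ξ, 0 < max c₁ (min c₀ (f ξ)) := fun ξ => lt_max_of_lt_left hc₁'
  have hVcont : Continuous V := by
    rw [continuous_iff_continuousAt]
    intro ξ
    obtain ⟨W', hW', -⟩ := hasDerivAt_rarefactionCurve hγ u₀ hρ₀ hc₀' (hpos ξ)
    exact ContinuousAt.comp (f := fun ξ => max c₁ (min c₀ (f ξ))) hW'.continuousAt
      (by fun_prop)
  have hVl : ∀ ξ, c₀ ≤ f ξ → V ξ = W c₀ := fun ξ h => by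
    simp only [hV, min_eq_left h, max_eq_right hc₁₀]
  have hVr : ∀ ξ, f ξ ≤ c₁ → V ξ = W c₁ := fun ξ h => by
    simp only [hV, min_eq_right (h.trans hc₁₀), max_eq_left h]
  have hVm : ∀ ξ, c₁ ≤ f ξ → f ξ ≤ c₀ → V ξ = W (f ξ) := fun ξ h h' => by
    simp only [hV, min_eq_right h', max_eq_right h]
  -- the rays on which the sound speed inside the fan is `c`
  set r : ℝ → ℝ := fun c => u₀ + 2 / (γ - 1) * c₀ - (γ + 1) / (γ - 1) * c with hr
  have hrf : ∀ ξ, r (f ξ) = ξ := fun ξ => by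
    simp only [hf, hr]
    field_simp
    ring
  have hanti : StrictAnti r := fun x y hxy => by
    have : (γ + 1) / (γ - 1) * x < (γ + 1) / (γ - 1) * y := by gcongr
    simp only [hr]
    linarith
  have hlt : ∀ c ξ, ξ < r c ↔ c < f ξ := fun c ξ => by
    rw [← hanti.lt_iff_gt (a := f ξ), hrf]
  have hgt : ∀ c ξ, r c < ξ ↔ f ξ < c := fun c ξ => by
    rw [← hanti.lt_iff_gt (b := f ξ), hrf]
  refine ⟨ρ₁, V, hρ₁', ?_⟩
  rw [← hW₀, ← hW₁]
  refine ⟨?_, r c₁, ?_, ?_⟩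
  · refine ⟨fun ξ => Or.inl (hWgas _ (hpos ξ)), ?_, ?_, {r c₀, r c₁}, ?_, ?_⟩
    · refine tendsto_const_nhds.congr' ?_
      filter_upwards [eventually_lt_atBot (r c₀)] with ξ hξ
      exact (hVl ξ ((hlt _ _).1 hξ).le).symm
    · refine tendsto_const_nhds.congr' ?_
      filter_upwards [eventually_gt_atTop (r c₁)] with ξ hξ
      exact (hVr ξ ((hgt _ _).1 hξ).le).symm
    · intro ξ hξ
      simp only [Finset.mem_insert, Finset.mem_singleton, not_or] at hξ
      rcases lt_or_gt_of_ne hξ.1 with h | h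
      · refine SolvesAt.of_eventually_eq (U := W c₀) ?_
        filter_upwards [Iio_mem_nhds h] with η hη
        exact hVl η ((hlt _ _).1 hη).le
      rcases lt_or_gt_of_ne hξ.2 with h' | h'
      · have hfξ : 0 < f ξ := hc₁'.trans ((hlt _ _).1 h')
        obtain ⟨W', hW', hFW⟩ := hasDerivAt_rarefactionCurve hγ u₀ hρ₀ hc₀' hfξ
        have df : HasDerivAt f (-((γ - 1) / (γ + 1))) ξ := by
          have := ((hasDerivAt_id ξ).const_sub (u₀ + 2 / (γ - 1) * c₀)).const_mul
            ((γ - 1) / (γ + 1))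
          simpa using this
        have hspeed : u₀ + 2 / (γ - 1) * (c₀ - f ξ) - f ξ = ξ := by
          have h1 := hrf ξ
          have h2 : (γ + 1) / (γ - 1) = 2 / (γ - 1) + 1 := by field_simp; ring
          simp only [hr, h2] at h1
          linarith
        have hsolves : SolvesAt γ (fun η => W (f η)) ξ := by
          refine ⟨_, hW'.scomp ξ df, ?_⟩
          have := hFW.scomp ξ df
          rwa [hspeed, smul_comm] at this
        refine hsolves.congr ?_
        filter_upwards [Ioi_mem_nhds h, Iio_mem_nhds h'] with η hη hη'
        exact hVm η ((hlt _ _).1 hη').le ((hgt _ _).1 hη).le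
      · refine SolvesAt.of_eventually_eq (U := W c₁) ?_
        filter_upwards [Ioi_mem_nhds h'] with η hη
        exact hVr η ((hgt _ _).1 hη).le
    · intro ξ _
      exact AdmissibleAt.of_continuousAt (Or.inl (hWgas _ (hpos ξ))) hVcont.continuousAt
        (ContinuousAt.comp (f := V) (continuousAt_flux γ (hWgas _ (hpos ξ)).1.ne')
          hVcont.continuousAt)
  · rw [hW₁, velocity_gasState hρ₁', hcurve]
    have : (γ + 1) / (γ - 1) * c₁ = 2 / (γ - 1) * c₁ + c₁ := by field_simp; ring
    simp only [hr]
    linarith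
  · intro ξ hξ
    exact hVr ξ ((hgt _ _).1 hξ).le

theorem exists_leftWave {γ : ℝ} (hγ : 1 < γ) {ρ₀ p₀ p : ℝ} (u₀ : ℝ) (hρ₀ : 0 < ρ₀)
    (hp₀ : 0 < p₀) (hp : 0 < p) : ∃ ρ V, 0 < ρ ∧
      IsLeftWave γ (gasState γ ρ₀ u₀ p₀) (gasState γ ρ (u₀ - waveCurve γ ρ₀ p₀ p) p) V := by
  rcases le_or_gt p p₀ with h | h
  · exact exists_rarefaction hγ u₀ hρ₀ hp₀ hp h
  · exact exists_shock hγ u₀ hρ₀ hp₀ h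

/-! ### Reflection -/

/-- The reflection `u ↦ -u`, the action on states of the symmetry `x ↦ -x` of the equations. -/
noncomputable def reflect : State →L[ℝ] State :=
  LinearMap.toContinuousLinearMap
    { toFun := fun U => !₂[U 0, -U 1, U 2]
      map_add' := fun U W => by
        ext i
        fin_cases i <;> simp
        ring
      map_smul' := fun c U => by
        ext i
        fin_cases i <;> simp }

theorem reflect_apply (U : State) : reflect U = !₂[U 0, -U 1, U 2] := rfl

theorem reflect_gasState (γ ρ u p : ℝ) :
    reflect (gasState γ ρ u p) = gasState γ ρ (-u) p := by
  rw [reflect_apply]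
  ext i
  fin_cases i <;> simp [gasState]

theorem velocity_reflect (U : State) : velocity (reflect U) = -velocity U := by
  simp [velocity, reflect_apply, neg_div]

theorem pressure_reflect (γ : ℝ) (U : State) : pressure γ (reflect U) = pressure γ U := by
  rw [pressure, velocity_reflect, neg_sq]
  rfl

theorem soundSpeed_reflect (γ : ℝ) (U : State) : soundSpeed γ (reflect U) = soundSpeed γ U := by
  rw [soundSpeed, pressure_reflect]
  rfl

theorem flux_reflect (γ : ℝ) (U : State) : flux γ (reflect U) = -reflect (flux γ U) := by
  rw [flux, pressure_reflect, velocity_reflect, reflect_apply, reflect_apply]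
  ext i
  fin_cases i <;> simp [flux]

theorem IsGas.reflect {γ : ℝ} {U : State} (h : IsGas γ U) : IsGas γ (reflect U) :=
  ⟨h.1, by rw [pressure_reflect]; exact h.2⟩

theorem IsPhysical.reflect {γ : ℝ} {U : State} (h : IsPhysical γ U) :
    IsPhysical γ (reflect U) := by
  rcases h with h | rfl
  · exact Or.inl h.reflect
  · exact Or.inr (map_zero _)

theorem flux_sub_reflect {γ s : ℝ} {Ul Ur : State} (h : flux γ Ur - flux γ Ul = s • (Ur - Ul)) :
    flux γ (reflect Ul) - flux γ (reflect Ur) = (-s) • (reflect Ul - reflect Ur) := by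
  rw [flux_reflect, flux_reflect, ← map_sub, neg_sub_neg, ← map_sub, h, map_smul, map_sub,
    map_sub]
  module

theorem IsContact.reflect {γ s : ℝ} {Ul Ur : State} (h : IsContact γ s Ul Ur) :
    IsContact γ (-s) (reflect Ur) (reflect Ul) := by
  obtain ⟨hl, hr, hne, hF, hul, hur, hp⟩ := h
  refine ⟨hr.reflect, hl.reflect, ?_, flux_sub_reflect hF, ?_, ?_, ?_⟩
  · intro heq
    apply hne
    have h0 := congrArg (fun U : State => U 0) heq
    have h1 := congrArg (fun U : State => U 1) heq
    have h2 := congrArg (fun U : State => U 2) heq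
    simp only [reflect_apply, PiLp.toLp_apply, Matrix.cons_val] at h0 h1 h2
    ext i
    fin_cases i
    exacts [h0.symm, (neg_injective h1).symm, h2.symm]
  · rw [velocity_reflect, hur]
  · rw [velocity_reflect, hul]
  · rw [pressure_reflect, pressure_reflect, hp]

theorem IsLaxShock.reflect {γ s : ℝ} {Ul Ur : State} (h : IsLaxShock γ s Ul Ur) :
    IsLaxShock γ (-s) (reflect Ur) (reflect Ul) := by
  obtain ⟨hl, hr, hF, hs⟩ := h
  refine ⟨hr.reflect, hl.reflect, flux_sub_reflect hF, ?_⟩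
  simp only [charSpeed, velocity_reflect, soundSpeed_reflect, Matrix.cons_val] at hs ⊢
  rcases hs with ⟨h1, h2, h3⟩ | ⟨h1, h2, h3⟩
  · exact Or.inr ⟨by linarith, by linarith, by linarith⟩
  · exact Or.inl ⟨by linarith, by linarith, by linarith⟩

theorem IsRiemannSolution.reflect {γ : ℝ} {UL UR : State} {V : ℝ → State}
    (h : IsRiemannSolution γ UL UR V) :
    IsRiemannSolution γ (reflect UR) (reflect UL) (fun ξ => SingularEuler.reflect (V (-ξ))) := by
  have hF : (fun η => flux γ (SingularEuler.reflect (V (-η)))) =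
      fun η => -SingularEuler.reflect (flux γ (V (-η))) := funext fun η => flux_reflect γ _
  have hc : ∀ U : State, Tendsto SingularEuler.reflect (𝓝 U) (𝓝 (SingularEuler.reflect U)) :=
    fun U => SingularEuler.reflect.continuous.tendsto U
  obtain ⟨J, hJ, hJ'⟩ := h.solves
  refine ⟨fun ξ => (h.physical _).reflect, (hc _).comp (h.right.comp tendsto_neg_atBot_atTop),
    (hc _).comp (h.left.comp tendsto_neg_atTop_atBot), J.image (fun x => -x), ?_, ?_⟩
  · intro ξ hξ
    obtain ⟨V', h1, h2⟩ := hJ (-ξ) (fun hmem => hξ (Finset.mem_image.2 ⟨-ξ, hmem, neg_neg ξ⟩))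
    have d1 := h1.scomp ξ (hasDerivAt_neg ξ)
    have d2 := h2.scomp ξ (hasDerivAt_neg ξ)
    refine ⟨-SingularEuler.reflect V', ?_, ?_⟩
    · exact (SingularEuler.reflect.hasFDerivAt.comp_hasDerivAt ξ d1).congr_deriv (by simp)
    · rw [hF]
      exact (SingularEuler.reflect.hasFDerivAt.comp_hasDerivAt ξ d2).neg.congr_deriv (by simp)
  · intro ξ hξ
    obtain ⟨x, hx, rfl⟩ := Finset.mem_image.1 hξ
    obtain ⟨Vl, Vr, hl, hr, h1, h2, h3, h4, h5⟩ := hJ' x hx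
    have nl : Tendsto (fun η : ℝ => -η) (𝓝[<] (-x)) (𝓝[>] x) := by
      simpa using tendsto_neg_nhdsLT (a := -x)
    have nr : Tendsto (fun η : ℝ => -η) (𝓝[>] (-x)) (𝓝[<] x) := by
      simpa using tendsto_neg_nhdsGT (a := -x)
    refine ⟨SingularEuler.reflect Vr, SingularEuler.reflect Vl, hr.reflect, hl.reflect,
      (hc _).comp (h2.comp nl), (hc _).comp (h1.comp nr), ?_, ?_, ?_⟩
    · rw [hF, flux_reflect]
      exact ((hc _).comp (h4.comp nl)).neg
    · rw [hF, flux_reflect]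
      exact ((hc _).comp (h3.comp nr)).neg
    · rcases h5 with h5 | h5 | h5
      · exact Or.inl (by rw [h5])
      · exact Or.inr (Or.inl h5.reflect)
      · exact Or.inr (Or.inr h5.reflect)

/-- The mirror image of `exists_leftWave`: a wave of the third family. -/
theorem exists_rightWave {γ : ℝ} (hγ : 1 < γ) {ρ₀ p₀ p : ℝ} (u₀ : ℝ) (hρ₀ : 0 < ρ₀)
    (hp₀ : 0 < p₀) (hp : 0 < p) : ∃ ρ V, 0 < ρ ∧
      IsRiemannSolution γ (gasState γ ρ (u₀ + waveCurve γ ρ₀ p₀ p) p) (gasState γ ρ₀ u₀ p₀) V ∧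
      ∃ σ > u₀ + waveCurve γ ρ₀ p₀ p, ∀ ξ < σ,
        V ξ = gasState γ ρ (u₀ + waveCurve γ ρ₀ p₀ p) p := by
  obtain ⟨ρ, V, hρ, hV, σ, hσ, hVσ⟩ := exists_leftWave hγ (-u₀) hρ₀ hp₀ hp
  rw [velocity_gasState hρ] at hσ
  have h := hV.reflect
  rw [reflect_gasState, reflect_gasState, neg_neg, neg_sub', neg_neg, sub_neg_eq_add] at h
  refine ⟨ρ, _, hρ, h, -σ, by linarith, fun ξ hξ => ?_⟩
  rw [hVσ (-ξ) (by linarith), reflect_gasState, neg_sub', neg_neg, sub_neg_eq_add]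

/-! ### The Riemann problem without vacuum -/

theorem isContact_gasState {γ ρ₁ ρ₂ u p : ℝ} (hγ : 1 < γ) (h₁ : 0 < ρ₁) (h₂ : 0 < ρ₂)
    (hp : 0 < p) (hne : ρ₁ ≠ ρ₂) : IsContact γ u (gasState γ ρ₁ u p) (gasState γ ρ₂ u p) := by
  have hg : γ - 1 ≠ 0 := by linarith
  refine ⟨isGas_gasState hγ h₁ hp, isGas_gasState hγ h₂ hp, ?_, ?_, velocity_gasState h₁,
    velocity_gasState h₂, by rw [pressure_gasState hγ h₁, pressure_gasState hγ h₂]⟩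
  · intro h
    exact hne (congrArg (fun U : State => U 0) h)
  · rw [flux_gasState hγ h₁, flux_gasState hγ h₂]
    ext i
    fin_cases i <;> simp [gasState] <;> ring

/-- Two Riemann solutions whose intermediate states are joined by a contact discontinuity of
speed `c`, the first one constant to the right of some `σ₁ < c` and the second one constant to the
left of some `σ₂ > c`, are glued along the ray `ξ = c`. -/
theorem IsRiemannSolution.glue {γ c σ₁ σ₂ : ℝ} {UL UR U₁ U₂ : State} {V₁ V₂ : ℝ → State}
    (h₁ : IsRiemannSolution γ UL U₁ V₁) (h₂ : IsRiemannSolution γ U₂ UR V₂)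
    (hσ₁ : σ₁ < c) (hσ₂ : c < σ₂) (hV₁ : ∀ ξ, σ₁ < ξ → V₁ ξ = U₁)
    (hV₂ : ∀ ξ < σ₂, V₂ ξ = U₂) (hU : U₁ = U₂ ∨ IsContact γ c U₁ U₂) :
    ∃ V, IsRiemannSolution γ UL UR V := by
  obtain ⟨J₁, hJ₁, hJ₁'⟩ := h₁.solves
  obtain ⟨J₂, hJ₂, hJ₂'⟩ := h₂.solves
  let V : ℝ → State := fun ξ => if ξ < c then V₁ ξ else V₂ ξ
  have hVl : ∀ ξ < c, V =ᶠ[𝓝 ξ] V₁ := fun ξ hξ => by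
    filter_upwards [Iio_mem_nhds hξ] with η hη using if_pos hη
  have hVr : ∀ ξ, c < ξ → V =ᶠ[𝓝 ξ] V₂ := fun ξ hξ => by
    filter_upwards [Ioi_mem_nhds hξ] with η hη using if_neg (not_lt.2 (le_of_lt hη))
  refine ⟨V, ?_, ?_, ?_, insert c (J₁ ∪ J₂), ?_, ?_⟩
  · intro ξ
    by_cases hξ : ξ < c
    · simpa only [V, if_pos hξ] using h₁.physical ξ
    · simpa only [V, if_neg hξ] using h₂.physical ξ
  · refine h₁.left.congr' ?_
    filter_upwards [eventually_lt_atBot c] with ξ hξ using (if_pos hξ).symm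
  · refine h₂.right.congr' ?_
    filter_upwards [eventually_gt_atTop c] with ξ hξ using (if_neg (not_lt.2 hξ.le)).symm
  · intro ξ hξ
    simp only [Finset.mem_insert, Finset.mem_union, not_or] at hξ
    rcases lt_or_gt_of_ne hξ.1 with h | h
    · exact SolvesAt.congr (hJ₁ ξ hξ.2.1) (hVl ξ h)
    · exact SolvesAt.congr (hJ₂ ξ hξ.2.2) (hVr ξ h)
  · intro ξ _
    rcases lt_trichotomy ξ c with h | rfl | h
    · refine AdmissibleAt.congr ?_ (hVl ξ h)
      by_cases hmem : ξ ∈ J₁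
      · exact hJ₁' ξ hmem
      · exact SolvesAt.admissibleAt (hJ₁ ξ hmem) (h₁.physical ξ)
    · refine AdmissibleAt.of_eq_of_eq (Vl := U₁) (Vr := U₂) ?_ ?_ ?_ ?_
        (hU.imp_right Or.inl)
      · rw [← hV₁ ξ hσ₁]
        exact h₁.physical ξ
      · rw [← hV₂ ξ hσ₂]
        exact h₂.physical ξ
      · filter_upwards [Ioo_mem_nhdsLT hσ₁] with η hη
        exact (if_pos hη.2).trans (hV₁ η hη.1)
      · filter_upwards [Ioo_mem_nhdsGT hσ₂] with η hη
        exact (if_neg (not_lt.2 hη.1.le)).trans (hV₂ η hη.2)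
    · refine AdmissibleAt.congr ?_ (hVr ξ h)
      by_cases hmem : ξ ∈ J₂
      · exact hJ₂' ξ hmem
      · exact SolvesAt.admissibleAt (hJ₂ ξ hmem) (h₂.physical ξ)

theorem continuousOn_waveCurve {γ ρ₀ p₀ : ℝ} (hγ : 1 < γ) (hρ₀ : 0 < ρ₀) (hp₀ : 0 < p₀) :
    ContinuousOn (waveCurve γ ρ₀ p₀) (Ici 0) := by
  have hg : 0 < γ - 1 := by linarith
  have hγ0 : 0 < γ := by linarith
  unfold waveCurve
  refine ContinuousOn.add (Continuous.continuousOn ?_) ?_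
  · refine continuous_const.mul (Continuous.sub ?_ continuous_const)
    exact Continuous.rpow_const (by fun_prop) (fun p => Or.inr (by positivity))
  · refine ContinuousOn.div (by fun_prop) (by fun_prop) (fun p hp => ?_)
    have : 0 < max p p₀ := lt_max_of_lt_right hp₀
    positivity

/-- At the vacuum the curve attains, up to sign, the largest velocity that a rarefaction can gain. -/
theorem waveCurve_zero {γ ρ₀ p₀ : ℝ} (hγ : 1 < γ) (hp₀ : 0 < p₀) :
    waveCurve γ ρ₀ p₀ 0 = -(2 / (γ - 1) * √(γ * p₀ / ρ₀)) := by
  have hg : 0 < γ - 1 := by linarith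
  have hγ0 : 0 < γ := by linarith
  have : (γ - 1) / (2 * γ) ≠ 0 := by positivity
  rw [waveCurve, min_eq_left hp₀.le, max_eq_right hp₀.le, zero_div, Real.zero_rpow this]
  simp

theorem tendsto_waveCurve_atTop {γ ρ₀ p₀ : ℝ} (hγ : 1 < γ) (hρ₀ : 0 < ρ₀) (hp₀ : 0 < p₀) :
    Tendsto (waveCurve γ ρ₀ p₀) atTop atTop := by
  rw [tendsto_atTop]
  intro B
  -- for `p ≥ 2 p₀` the pressure jump is at least `p / 2`, the mass flux at most `√(ρ₀ γ p)`
  filter_upwards [eventually_ge_atTop (2 * p₀), eventually_ge_atTop (4 * B ^ 2 * ρ₀ * γ)]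
    with p hp hpB
  have hg : 0 < γ - 1 := by linarith
  have hle : p₀ ≤ p := by linarith
  have hp' : 0 < p := by linarith
  rw [waveCurve, max_eq_left hle, min_eq_right hle, div_self hp₀.ne', Real.one_rpow, sub_self,
    mul_zero, zero_add]
  have hq : 0 < ρ₀ * ((γ + 1) * p + (γ - 1) * p₀) / 2 := by positivity
  rw [le_div_iff₀ (Real.sqrt_pos.2 hq)]
  have hsq : (B * √(ρ₀ * ((γ + 1) * p + (γ - 1) * p₀) / 2)) ^ 2 ≤ (p / 2) ^ 2 := by
    rw [mul_pow, Real.sq_sqrt hq.le]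
    have h1 : (γ + 1) * p + (γ - 1) * p₀ ≤ 2 * γ * p := by nlinarith
    calc B ^ 2 * (ρ₀ * ((γ + 1) * p + (γ - 1) * p₀) / 2)
        ≤ B ^ 2 * (ρ₀ * (2 * γ * p) / 2) := by gcongr
      _ = 4 * B ^ 2 * ρ₀ * γ * p / 4 := by ring
      _ ≤ p * p / 4 := by gcongr
      _ = (p / 2) ^ 2 := by ring
  have := (le_abs_self _).trans (abs_le_of_sq_le_sq hsq (by positivity))
  linarith

/-- The Riemann problem has a solution whenever the data do not create a vacuum: the two wave
curves in the `(p, u)`-plane intersect at a positive pressure. -/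
theorem exists_isRiemannSolution {γ : ℝ} (hγ : 1 < γ) {ρl ul pl ρr ur pr : ℝ} (hρl : 0 < ρl)
    (hpl : 0 < pl) (hρr : 0 < ρr) (hpr : 0 < pr)
    (hvac : ur - ul < 2 / (γ - 1) * √(γ * pl / ρl) + 2 / (γ - 1) * √(γ * pr / ρr)) :
    ∃ V, IsRiemannSolution γ (gasState γ ρl ul pl) (gasState γ ρr ur pr) V := by
  let g : ℝ → ℝ := fun p => waveCurve γ ρl pl p + waveCurve γ ρr pr p + (ur - ul)
  have hg : ContinuousOn g (Ici 0) :=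
    ((continuousOn_waveCurve hγ hρl hpl).add (continuousOn_waveCurve hγ hρr hpr)).add
      continuousOn_const
  have hg0 : g 0 < 0 := by
    simp only [g, waveCurve_zero hγ hpl, waveCurve_zero hγ hpr]
    linarith
  obtain ⟨P, hP1, hP2, hP0⟩ := (((tendsto_waveCurve_atTop hγ hρl hpl).eventually_ge_atTop
    (ul - ur)).and (((tendsto_waveCurve_atTop hγ hρr hpr).eventually_ge_atTop 0).and
      (eventually_ge_atTop 0))).exists
  have hgP : 0 ≤ g P := by
    simp only [g]
    linarith
  obtain ⟨p, hp, hgp⟩ := intermediate_value_Icc hP0 (hg.mono Icc_subset_Ici_self)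
    ⟨hg0.le, hgP⟩
  have hp0 : 0 < p := by
    rcases hp.1.eq_or_lt with h | h
    · rw [← h] at hgp
      linarith
    · exact h
  obtain ⟨ρ₁, V₁, hρ₁, h₁, σ₁, hσ₁, hV₁⟩ := exists_leftWave hγ ul hρl hpl hp0
  obtain ⟨ρ₂, V₂, hρ₂, h₂, σ₂, hσ₂, hV₂⟩ := exists_rightWave hγ ur hρr hpr hp0
  rw [velocity_gasState hρ₁] at hσ₁
  have hu : ur + waveCurve γ ρr pr p = ul - waveCurve γ ρl pl p := by
    simp only [g] at hgp
    linarith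
  rw [hu] at h₂ hσ₂ hV₂
  refine h₁.glue h₂ hσ₁ hσ₂ hV₁ hV₂ ?_
  rcases eq_or_ne ρ₁ ρ₂ with h | h
  · exact Or.inl (by rw [h])
  · exact Or.inr (isContact_gasState hγ hρ₁ hρ₂ hp0 h)

/-! ### A slow stationary wave -/

/-- In terms of the squared Mach number `t`, the quantity `m e / n ^ 2` formed from the mass flux
`m`, the momentum flux `n` and the energy flux `e` is a constant multiple of this function. -/
noncomputable def machFunction (γ t : ℝ) : ℝ := t * ((γ - 1) * t + 2) / (γ * t + 1) ^ 2

theorem exists_machFunction_eq {γ : ℝ} (hγ : 1 < γ) {K η : ℝ} (hK : 0 < K) (hη : 0 < η) :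
    ∃ s t, 0 < s ∧ s ≤ η ∧ 0 < t ∧ t ≤ η ∧ machFunction γ t = K * machFunction γ s := by
  have hg : 0 < γ - 1 := by linarith
  have hc : ContinuousOn (machFunction γ) (Icc 0 η) := by
    unfold machFunction
    refine ContinuousOn.div (by fun_prop) (by fun_prop) (fun t ht => ?_)
    have := ht.1
    positivity
  have h0 : machFunction γ 0 = 0 := by simp [machFunction]
  have hη' : 0 < machFunction γ η := by unfold machFunction; positivity
  have key : ∀ c, 0 < c → c ≤ machFunction γ η → ∃ t, 0 < t ∧ t ≤ η ∧ machFunction γ t = c := by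
    intro c hc0 hcη
    obtain ⟨t, ht, rfl⟩ := intermediate_value_Icc hη.le hc ⟨h0.trans_le hc0.le, hcη⟩
    refine ⟨t, ht.1.lt_of_ne ?_, ht.2, rfl⟩
    rintro rfl
    exact hc0.ne' h0
  set c := min (machFunction γ η) (machFunction γ η / K)
  obtain ⟨s, hs, hsη, hsc⟩ := key c (by positivity) (min_le_left _ _)
  obtain ⟨t, ht, htη, htc⟩ := key (K * c) (by positivity)
    ((le_div_iff₀' hK).1 (min_le_right _ _))
  exact ⟨s, t, hs, hsη, ht, htη, by rw [htc, hsc]⟩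

/-- For all source strengths there is a right-going stationary wave that is so slow, compared to
the sound speeds, that it is subsonic and its classical Riemann problem has no vacuum. -/
theorem exists_isStationaryWave {γ : ℝ} (hγ : 1 < γ) {k : Fin 3 → ℝ} (hk : ∀ i, -1 < k i) :
    ∃ ρl ul pl ρr ur pr : ℝ, 0 < ρl ∧ 0 < ul ∧ 0 < pl ∧ 0 < ρr ∧ 0 < pr ∧
      IsStationaryWave γ k (gasState γ ρl ul pl) (gasState γ ρr ur pr) ∧
      ur - ul < 2 / (γ - 1) * √(γ * pl / ρl) + 2 / (γ - 1) * √(γ * pr / ρr) := by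
  have hg : 0 < γ - 1 := by linarith
  have hγ0 : 0 < γ := by linarith
  have hk0 : 0 < 1 + k 0 := by linarith [hk 0]
  have hk1 : 0 < 1 + k 1 := by linarith [hk 1]
  have hk2 : 0 < 1 + k 2 := by linarith [hk 2]
  -- Mach numbers below `1` make the wave subsonic, those below `2 / (γ - 1)` exclude the vacuum
  set ε := min 1 (2 / (γ - 1)) / 2 with hε
  have hε0 : 0 < ε := by positivity
  have hε1 : ε < 1 := by
    have := min_le_left 1 (2 / (γ - 1))
    linarith
  have hε2 : ε < 2 / (γ - 1) := by
    have := min_le_right 1 (2 / (γ - 1))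
    linarith
  obtain ⟨s, t, hs, hsε, ht, htε, hst⟩ := exists_machFunction_eq hγ
    (K := (1 + k 0) * (1 + k 2) / (1 + k 1) ^ 2) (η := ε ^ 2) (by positivity) (by positivity)
  -- the Mach numbers of the two states
  obtain ⟨μ, hμ, rfl⟩ : ∃ μ, 0 < μ ∧ μ ^ 2 = s := ⟨√s, Real.sqrt_pos.2 hs, Real.sq_sqrt hs.le⟩
  obtain ⟨ν, hν, rfl⟩ : ∃ ν, 0 < ν ∧ ν ^ 2 = t := ⟨√t, Real.sqrt_pos.2 ht, Real.sq_sqrt ht.le⟩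
  replace hsε : μ ≤ ε := (pow_le_pow_iff_left₀ hμ.le hε0.le two_ne_zero).1 hsε
  replace htε : ν ≤ ε := (pow_le_pow_iff_left₀ hν.le hε0.le two_ne_zero).1 htε
  set p := (1 + k 1) * (γ * μ ^ 2 + 1) / (γ * (γ * ν ^ 2 + 1)) with hp
  have hp0 : 0 < p := by positivity
  set u := γ * p * ν ^ 2 / ((1 + k 0) * μ) with hu
  have hu0 : 0 < u := by positivity
  set ρ := (1 + k 0) * μ / u with hρ
  have hρ0 : 0 < ρ := by positivity
  have hmass : ρ * u = (1 + k 0) * μ := by rw [hρ]; field_simp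
  have hdyn : ρ * u ^ 2 = γ * p * ν ^ 2 := by
    rw [pow_two, ← mul_assoc, hmass, hu]
    field_simp
  have hmom : ρ * u ^ 2 + p = (1 + k 1) * (μ ^ 2 + 1 / γ) := by
    rw [hdyn, hp]
    field_simp
  have hen : (γ / (γ - 1) * p + ρ * u ^ 2 / 2) * u =
      (1 + k 2) * ((1 / (γ - 1) + μ ^ 2 / 2) * μ) := by
    rw [hdyn, hu, hp]
    simp only [machFunction] at hst
    field_simp at hst ⊢
    linear_combination hst
  have hal : √(γ * (1 / γ) / 1) = 1 := by
    rw [mul_one_div_cancel hγ0.ne']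
    simp
  have har : √(γ * p / ρ) = u / ν := by
    have : γ * p / ρ = (u / ν) ^ 2 := by
      field_simp
      linarith
    rw [this, Real.sqrt_sq (by positivity)]
  have hul : μ < 1 := hsε.trans_lt hε1
  have hur : u < u / ν := by
    rw [lt_div_iff₀ hν]
    nlinarith
  have hur' : u < 2 / (γ - 1) * (u / ν) := by
    rw [← mul_div_assoc, lt_div_iff₀ hν, mul_comm]
    gcongr
    exact htε.trans_lt hε2
  refine ⟨1, μ, 1 / γ, ρ, u, p, one_pos, hμ, by positivity, hρ0, hp0, ?_, ?_⟩
  · have hvel : 0 < velocity (gasState γ 1 μ (1 / γ)) ∧ 0 < velocity (gasState γ ρ u p) := by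
      rw [velocity_gasState one_pos, velocity_gasState hρ0]
      exact ⟨hμ, hu0⟩
    refine ⟨isGas_gasState hγ one_pos (by positivity), isGas_gasState hγ hρ0 hp0,
      Or.inl hvel, ?_, ?_⟩
    · rw [source, if_pos hvel, flux_gasState hγ one_pos, flux_gasState hγ hρ0, hmass, hmom, hen]
      ext i
      fin_cases i
      · simp
        ring
      · simp
        ring
      · simp
        field_simp
    · intro i
      have h0 : charSpeed γ (gasState γ 1 μ (1 / γ)) = ![μ - 1, μ, μ + 1] := by
        rw [charSpeed, velocity_gasState one_pos, soundSpeed_gasState hγ one_pos, hal]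
      have h1 : charSpeed γ (gasState γ ρ u p) = ![u - u / ν, u, u + u / ν] := by
        rw [charSpeed, velocity_gasState hρ0, soundSpeed_gasState hγ hρ0, har]
      rw [h0, h1]
      fin_cases i
      · exact mul_nonneg_of_nonpos_of_nonpos (by simpa using hul.le) (by simpa using hur.le)
      · exact mul_nonneg hμ.le hu0.le
      · exact mul_nonneg (by simpa using by positivity) (by simpa using by positivity)
  · rw [hal, har]
    have : 0 < 2 / (γ - 1) := by positivity
    linarith

/-! ### The splitting method -/

/-- After a convection step the source step can be performed, without any effect: the source is
multiplied by a weight that vanishes off the origin. -/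
theorem ConvectionStep.splittingStep {γ : ℝ} (k : Fin 3 → ℝ) {t : ℝ} (ht : 0 < t)
    {V Z : ℝ → State} (h : ConvectionStep γ t V Z) : SplittingStep γ k t V Z := by
  obtain ⟨Vl, Vr, h1, h2, -⟩ := h.exists_limits ht
  refine ⟨Z, h, fun _ => Z, fun _ => Vl, fun _ => Vr, fun _ => rfl, fun _ => rfl,
    fun _ _ => ⟨h1, h2⟩, fun x hx τ _ => ?_⟩
  have hx0 : x ≠ 0 := fun h0 => hx (by simp [delta, h0])
  have hδ : (delta x).toReal = 0 := by simp [delta, hx0]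
  rw [hδ, zero_smul]
  exact hasDerivWithinAt_const _ _ _

theorem not_isWellBalanced {γ : ℝ} (hγ : 1 < γ) {k : Fin 3 → ℝ} (hk : ∀ i, -1 < k i)
    (hk0 : k ≠ 0) {dt : ℝ} (hdt : 0 < dt) {a b : ℝ} (ha : a < 0) (hb : 0 < b) :
    ¬ IsWellBalanced γ k dt a b := by
  intro hwb
  obtain ⟨ρl, ul, pl, ρr, ur, pr, hρl, hul, hpl, hρr, hpr, hw, hvac⟩ :=
    exists_isStationaryWave hγ hk
  obtain ⟨R, hR⟩ := exists_isRiemannSolution hγ hρl hpl hρr hpr hvac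
  set Um := gasState γ ρl ul pl
  set Up := gasState γ ρr ur pr
  have hZ : ConvectionStep γ dt (riemannData Um Up) (fun x => R (x / dt)) :=
    ⟨Um, Up, R, EventuallyEq.rfl, hR, fun _ => rfl⟩
  let U : ℕ → ℝ → State := fun n => if n = 0 then riemannData Um Up else fun x => R (x / dt)
  refine hw.not_ae_eq hγ hk0 hdt ha hb hZ
    (hwb Um Up hw (by rwa [velocity_gasState hρl]) 1 U rfl fun m hm => ?_)
  rw [Nat.lt_one_iff.1 hm]
  exact hZ.splittingStep k hdt

end SingularEuler

theorem mainTheorem3 (γ : ℝ) (hγ : 1 < γ) (k : Fin 3 → ℝ) (hk : ∀ i, -1 < k i) (hk0 : k ≠ 0)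
    (dt : ℝ) (hdt : 0 < dt) (a b : ℝ) (ha : a < 0) (hb : 0 < b) :
    ¬ SingularEuler.IsWellBalanced γ k dt a b ∧
    ∀ Um Up : SingularEuler.State, SingularEuler.IsStationaryWave γ k Um Up →
      ¬ SingularEuler.IsContact γ 0 Um Up ∧
      ¬ SingularEuler.IsLaxShock γ 0 Um Up ∧
      ∀ Z : ℝ → SingularEuler.State,
        SingularEuler.ConvectionStep γ dt (SingularEuler.riemannData Um Up) Z →
        MeasureTheory.eLpNorm (fun x => Z x - SingularEuler.riemannData Um Up x) 2
            (MeasureTheory.volume.restrict (Set.Ioo a b)) ≠ 0 ∧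
        ∀ W : ℝ → SingularEuler.State, SingularEuler.SourceStep γ k dt Z W →
          MeasureTheory.eLpNorm (fun x => W x - SingularEuler.riemannData Um Up x) 2
            (MeasureTheory.volume.restrict (Set.Ioo a b)) ≠ 0 := by
  refine ⟨SingularEuler.not_isWellBalanced hγ hk hk0 hdt ha hb, fun Um Up hw =>
    ⟨hw.not_isContact, hw.not_isLaxShock hγ hk0, fun Z hZ => ⟨?_, fun W hW => ?_⟩⟩⟩
  · exact hw.eLpNorm_ne_zero hγ hk0 hdt ha hb hZ EventuallyEq.rfl
  · exact hw.eLpNorm_ne_zero hγ hk0 hdt ha hb hZ (hW.ae_eq hdt)
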